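/- Let $k$ be an algebraically closed field, let $\Lambda$ be a finite-dimensional $k$-algebra, let $\operatorname{mod}\Lambda$ be the category of finitely generated $\Lambda$-modules, and let $K_0(\operatorname{proj}\Lambda)$ be the Grothendieck group of finitely generated projective $\Lambda$-modules. Put $K_0(\operatorname{proj}\Lambda)_{\mathbb R}=\mathbb R\otimes_{\mathbb Z}K_0(\operatorname{proj}\Lambda)$, a finite-dimensional real vector space with its usual topology. For $M\in\operatorname{mod}\Lambda$ let $\langle -,[M]\rangle\colon K_0(\operatorname{proj}\Lambda)_{\mathbb R}\to\mathbb R$ be the $\mathbb R$-linear form with $\langle [P],[M]\rangle=\dim_k\operatorname{Hom}_\Lambda(P,M)$. For $\theta\in K_0(\operatorname{proj}\Lambda)_{\mathbb R}$ set $$\overline{\mathcal T}_\theta=\{M\in\operatorname{mod}\Lambda\mid \langle\theta,[M']\rangle\ge 0\text{ for every factor module }M'\text{ of }M\},$$ $$\overline{\mathcal F}_\theta=\{M\in\operatorname{mod}\Lambda\mid \langle\theta,[M']\rangle\le 0\text{ for every submodule }M'\text{ of }M\},$$ and let $[\theta]_{\mathrm{TF}}=\{\eta\mid \overline{\mathcal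 T}_\eta=\overline{\mathcal T}_\theta\text{ and }\overline{\mathcal F}_\eta=\overline{\mathcal F}_\theta\}$. For a subset $X$ of $K_0(\operatorname{proj}\Lambda)_{\mathbb R}$ let $\langle X\rangle_{\mathbb R}$ be its linear span, $X^\circ$ the interior of $X$ relative to $\langle X\rangle_{\mathbb R}$, and $\partial X=\overline X\setminus X^\circ$. Let $\theta,\eta\in K_0(\operatorname{proj}\Lambda)_{\mathbb R}$. If $\eta\in\partial[\theta]_{\mathrm{TF}}\setminus[\theta]_{\mathrm{TF}}$, then $$\dim_{\mathbb R}\langle[\eta]_{\mathrm{TF}}\rangle_{\mathbb R}<\dim_{\mathbb R}\langle[\theta]_{\mathrm{TF}}\rangle_{\mathbb R}.$$ -/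

import Mathlib

namespace TFClasses

universe v u

/-- A finitely generated projective `Λ`-module. -/
structure ProjMod (Λ : Type u) [Ring Λ] : Type (u + 1) where
  carrier : Type u
  [addCommGroup : AddCommGroup carrier]
  [module : Module Λ carrier]
  [finite : Module.Finite Λ carrier]
  [projective : Module.Projective Λ carrier]

attribute [instance] ProjMod.addCommGroup ProjMod.module ProjMod.finite ProjMod.projective

/-- The relations `[R] = [P] + [Q]` for `R ≅ P ⊕ Q` (every short exact sequence of projectives
splits). Isomorphic modules are thereby identified: take `Q = 0`. -/
def k0Relations (Λ : Type u) [Ring Λ] : AddSubgroup (FreeAbelianGroup (ProjMod Λ)) :=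
  AddSubgroup.closure
    {x | ∃ P Q R : ProjMod Λ, Nonempty (R.carrier ≃ₗ[Λ] (P.carrier × Q.carrier)) ∧
      x = FreeAbelianGroup.of R - (FreeAbelianGroup.of P + FreeAbelianGroup.of Q)}

/-- The Grothendieck group `K₀(proj Λ)`. -/
abbrev K0Proj (Λ : Type u) [Ring Λ] : Type (u + 1) :=
  FreeAbelianGroup (ProjMod Λ) ⧸ k0Relations Λ

/-- The real Grothendieck group `K₀(proj Λ)_ℝ = ℝ ⊗ K₀(proj Λ)`. -/
abbrev K0ProjReal (Λ : Type u) [Ring Λ] : Type (u + 1) :=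
  TensorProduct ℤ ℝ (K0Proj Λ)

/-- `K₀(proj Λ)_ℝ` carries the canonical topology of a real vector space. For a
finite-dimensional algebra `Λ` this space is finite-dimensional, and the module topology is its
Euclidean topology. -/
noncomputable instance instTopologicalSpaceK0ProjReal (Λ : Type u) [Ring Λ] :
    TopologicalSpace (K0ProjReal Λ) :=
  moduleTopology ℝ (K0ProjReal Λ)

instance instIsModuleTopologyK0ProjReal (Λ : Type u) [Ring Λ] :
    IsModuleTopology ℝ (K0ProjReal Λ) := ⟨rfl⟩

/-- A finitely generated `Λ`-module (an object of `mod Λ`), with its underlying `k`-vector space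
structure. -/
structure FinMod (k : Type v) [Field k] (Λ : Type u) [Ring Λ] [Algebra k Λ] :
    Type (max v (u + 1)) where
  carrier : Type u
  [addCommGroup : AddCommGroup carrier]
  [kModule : Module k carrier]
  [module : Module Λ carrier]
  [isScalarTower : IsScalarTower k Λ carrier]
  [finite : Module.Finite Λ carrier]

attribute [instance] FinMod.addCommGroup FinMod.kModule FinMod.module FinMod.isScalarTower
  FinMod.finite

/-- Over a finite-dimensional algebra, submodules of finitely generated modules are finitely
generated. -/
theorem finite_submodule (k : Type v) [Field k] {Λ : Type u} [Ring Λ] [Algebra k Λ]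
    [Module.Finite k Λ] {M : Type u} [AddCommGroup M] [Module Λ M] [Module.Finite Λ M]
    (N : Submodule Λ M) : Module.Finite Λ N := by
  have : IsNoetherianRing Λ := IsNoetherianRing.of_finite k Λ
  infer_instance

section Pairing

variable (k : Type v) [Field k] {Λ : Type u} [Ring Λ] [Algebra k Λ] [Module.Finite k Λ]
variable (M : Type u) [AddCommGroup M] [Module k M] [Module Λ M] [IsScalarTower k Λ M]

theorem finite_hom [Module.Finite Λ M] (P : ProjMod Λ) :
    Module.Finite k (P.carrier →ₗ[Λ] M) := by
  have : Module.Finite k M := Module.Finite.trans Λ M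
  obtain ⟨n, f, hf⟩ := Module.Finite.exists_fin' Λ P.carrier
  refine Module.Finite.of_injective
    (LinearMap.pi fun i : Fin n => LinearMap.applyₗ' k (f (Pi.single i 1)) :
      (P.carrier →ₗ[Λ] M) →ₗ[k] (Fin n → M)) ?_
  intro g h hgh
  have key : g.comp f = h.comp f := by
    refine LinearMap.pi_ext' fun i => LinearMap.ext_ring ?_
    exact congrFun hgh i
  ext x
  obtain ⟨y, rfl⟩ := hf x
  exact LinearMap.congr_fun key y

/-- The additive map `K₀(proj Λ) → ℤ`, `[P] ↦ dim_k Hom_Λ(P, M)`. -/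
noncomputable def eulerHom [Module.Finite Λ M] : K0Proj Λ →+ ℤ :=
  QuotientAddGroup.lift (k0Relations Λ)
    (FreeAbelianGroup.lift fun P : ProjMod Λ =>
      (Module.finrank k (P.carrier →ₗ[Λ] M) : ℤ)) (by
    refine (AddSubgroup.closure_le _).2 ?_
    rintro x ⟨P, Q, R, ⟨e⟩, rfl⟩
    have := finite_hom k M P
    have := finite_hom k M Q
    have h : Module.finrank k (R.carrier →ₗ[Λ] M) =
        Module.finrank k (P.carrier →ₗ[Λ] M) + Module.finrank k (Q.carrier →ₗ[Λ] M) := by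
      rw [← Module.finrank_prod]
      exact LinearEquiv.finrank_eq
        ((LinearEquiv.congrLeft M k e).trans (LinearMap.coprodEquiv k).symm)
    simp [h])

/-- The Euler form `θ ↦ ⟨θ, [M]⟩`, the `ℝ`-linear extension of
`⟨[P], [M]⟩ = dim_k Hom_Λ(P, M)` to `K₀(proj Λ)_ℝ`. -/
noncomputable def pairing [Module.Finite Λ M] : K0ProjReal Λ →ₗ[ℝ] ℝ :=
  (TensorProduct.AlgebraTensorModule.rid ℤ ℝ ℝ).toLinearMap ∘ₗ
    (eulerHom k M).toIntLinearMap.baseChange ℝ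

end Pairing

section TF

variable (k : Type v) [Field k] {Λ : Type u} [Ring Λ] [Algebra k Λ] [Module.Finite k Λ]

/-- `T̄_θ`: the modules all of whose factor modules `M'` satisfy `⟨θ, [M']⟩ ≥ 0`. -/
def torsBar (θ : K0ProjReal Λ) : Set (FinMod k Λ) :=
  {M | ∀ N : Submodule Λ M.carrier, 0 ≤ pairing k (M.carrier ⧸ N) θ}

/-- `F̄_θ`: the modules all of whose submodules `M'` satisfy `⟨θ, [M']⟩ ≤ 0`. -/
def torfBar (θ : K0ProjReal Λ) : Set (FinMod k Λ) :=
  {M | ∀ N : Submodule Λ M.carrier,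
    haveI := finite_submodule k N
    pairing k N θ ≤ 0}

/-- The TF-equivalence class `[θ]_TF`. -/
def tfClass (θ : K0ProjReal Λ) : Set (K0ProjReal Λ) :=
  {η | torsBar k θ = torsBar k η ∧ torfBar k θ = torfBar k η}

end TF

section RelativeTopology

variable {E : Type*} [AddCommGroup E] [Module ℝ E] [TopologicalSpace E]

/-- The interior of `X` relative to its linear span. -/
def relInterior (X : Set E) : Set E :=
  ((↑) : Submodule.span ℝ X → E) '' interior (((↑) : Submodule.span ℝ X → E) ⁻¹' X)

/-- The boundary of `X`: its closure minus its interior relative to its linear span. -/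
def relBoundary (X : Set E) : Set E :=
  closure X \ relInterior X

end RelativeTopology

end TFClasses

namespace TFClasses

universe v u

/-! ### Additivity of the Euler form on short exact sequences -/

section Additivity

variable (k : Type v) [Field k] {Λ : Type u} [Ring Λ] [Algebra k Λ] [Module.Finite k Λ]

/-! If `η` lies in the closure of `[θ]`, then `T̄_θ ⊆ T̄_η` and `F̄_θ ⊆ F̄_η`, since membership is
cut out by closed half-spaces. These inclusions force `x + θ ∈ [θ]` for every `x ∈ [η]`
(`add_mem_tfClass`), so the span of `[η]` lies in that of `[θ]`. If the spans agreed, then `θ = a -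
b` with `a, b ∈ [η]`, because `[η]` is closed under sums and positive multiples. Then `a = b + θ`
would lie in both classes, forcing `η ∈ [θ]` (`span_tfClass_lt_of_mem_closure`). Strict inclusion of
spans gives strict inequality of dimensions once `K₀(proj Λ)_ℝ` is finite-dimensional; this follows
from `K0Proj.fg`, a count of indecomposable projectives by their simple factors. -/

theorem pairing_one_tmul_of (M : Type u) [AddCommGroup M] [Module k M] [Module Λ M]
    [IsScalarTower k Λ M] [Module.Finite Λ M] (r : ℝ) (P : ProjMod Λ) :
    pairing k M (r ⊗ₜ[ℤ] (QuotientAddGroup.mk (FreeAbelianGroup.of P) : K0Proj Λ)) =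
      (Module.finrank k (P.carrier →ₗ[Λ] M) : ℝ) * r := by
  have h : eulerHom k M (QuotientAddGroup.mk (FreeAbelianGroup.of P) : K0Proj Λ) =
      (Module.finrank k (P.carrier →ₗ[Λ] M) : ℤ) :=
    FreeAbelianGroup.lift_apply_of _ _
  simp [pairing, h]

theorem K0ProjReal.linearMap_ext {E : Type*} [AddCommGroup E] [Module ℝ E]
    {f g : K0ProjReal Λ →ₗ[ℝ] E}
    (h : ∀ (r : ℝ) (P : ProjMod Λ),
      f (r ⊗ₜ[ℤ] (QuotientAddGroup.mk (FreeAbelianGroup.of P) : K0Proj Λ)) =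
        g (r ⊗ₜ[ℤ] (QuotientAddGroup.mk (FreeAbelianGroup.of P) : K0Proj Λ))) : f = g := by
  refine LinearMap.ext fun x => ?_
  induction x using TensorProduct.induction_on with
  | zero => simp
  | add x y hx hy => simp [hx, hy]
  | tmul r y =>
    obtain ⟨y, rfl⟩ := QuotientAddGroup.mk_surjective y
    induction y using FreeAbelianGroup.induction_on with
    | zero => simp
    | of P => exact h r P
    | neg P hP => simpa [TensorProduct.tmul_neg] using hP
    | add a b ha hb => simp [TensorProduct.tmul_add, ha, hb]

variable {A B C : Type u}
  [AddCommGroup A] [Module k A] [Module Λ A] [IsScalarTower k Λ A] [Module.Finite Λ A]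
  [AddCommGroup B] [Module k B] [Module Λ B] [IsScalarTower k Λ B] [Module.Finite Λ B]
  [AddCommGroup C] [Module k C] [Module Λ C] [IsScalarTower k Λ C] [Module.Finite Λ C]

/-- Projectivity of `P` makes `Hom(P, -)` exact; rank-nullity does the rest. -/
theorem finrank_hom_of_exact (P : ProjMod Λ) (f : A →ₗ[Λ] B) (g : B →ₗ[Λ] C)
    (hf : Function.Injective f) (hg : Function.Surjective g) (hfg : Function.Exact f g) :
    Module.finrank k (P.carrier →ₗ[Λ] B) =
      Module.finrank k (P.carrier →ₗ[Λ] A) + Module.finrank k (P.carrier →ₗ[Λ] C) := by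
  have := finite_hom k A P
  have := finite_hom k B P
  have := finite_hom k C P
  let F : (P.carrier →ₗ[Λ] A) →ₗ[k] (P.carrier →ₗ[Λ] B) :=
    { toFun := fun h => f ∘ₗ h
      map_add' := fun _ _ => LinearMap.comp_add _ _ _
      map_smul' := fun c h => LinearMap.ext fun x =>
        LinearMap.map_smul_of_tower f c (h x) }
  let G : (P.carrier →ₗ[Λ] B) →ₗ[k] (P.carrier →ₗ[Λ] C) :=
    { toFun := fun h => g ∘ₗ h
      map_add' := fun _ _ => LinearMap.comp_add _ _ _
      map_smul' := fun c h => LinearMap.ext fun x =>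
        LinearMap.map_smul_of_tower g c (h x) }
  have hF : Function.Injective F := fun a b hab =>
    LinearMap.ext fun x => hf (LinearMap.congr_fun hab x)
  have hG : Function.Surjective G := fun c => Module.projective_lifting_property g c hg
  have hFG : LinearMap.range F = LinearMap.ker G := by
    ext h
    constructor
    · rintro ⟨a, rfl⟩
      exact LinearMap.ext fun x => hfg.apply_apply_eq_zero (a x)
    · intro hh
      have hmem : ∀ x, h x ∈ LinearMap.range f := fun x =>
        (hfg (h x)).1 (LinearMap.congr_fun (LinearMap.mem_ker.1 hh) x)
      refine ⟨(LinearEquiv.ofInjective f hf).symm.toLinearMap ∘ₗ h.codRestrict _ hmem, ?_⟩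
      refine LinearMap.ext fun x => ?_
      have := LinearEquiv.ofInjective_symm_apply (f := f) (h := hf) ⟨h x, hmem x⟩
      exact this
  have h1 := LinearMap.finrank_range_add_finrank_ker G
  rw [LinearMap.range_eq_top.2 hG, finrank_top, ← hFG, LinearMap.finrank_range_of_inj hF] at h1
  omega

theorem pairing_of_exact (f : A →ₗ[Λ] B) (g : B →ₗ[Λ] C)
    (hf : Function.Injective f) (hg : Function.Surjective g) (hfg : Function.Exact f g)
    (θ : K0ProjReal Λ) : pairing k B θ = pairing k A θ + pairing k C θ := by
  have h : pairing (Λ := Λ) k B = pairing k A + pairing k C := by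
    refine K0ProjReal.linearMap_ext fun r P => ?_
    rw [LinearMap.add_apply, pairing_one_tmul_of, pairing_one_tmul_of, pairing_one_tmul_of,
      finrank_hom_of_exact k P f g hf hg hfg]
    push_cast
    ring
  rw [h, LinearMap.add_apply]

theorem pairing_of_equiv (e : A ≃ₗ[Λ] B) (θ : K0ProjReal Λ) : pairing k A θ = pairing k B θ := by
  have h : pairing (Λ := Λ) k A = pairing k B := by
    refine K0ProjReal.linearMap_ext fun r P => ?_
    -- View the isomorphism as a short exact sequence with zero kernel.
    rw [pairing_one_tmul_of, pairing_one_tmul_of, finrank_hom_of_exact k P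
      (0 : (⊥ : Submodule Λ A) →ₗ[Λ] A) e.toLinearMap (Function.injective_of_subsingleton _)
      e.surjective (by
        intro y
        constructor
        · intro hy
          exact ⟨0, by simpa using ((map_eq_zero_iff e e.injective).1 hy).symm⟩
        · rintro ⟨x, rfl⟩
          simp)]
    have : Module.finrank k (P.carrier →ₗ[Λ] (⊥ : Submodule Λ A)) = 0 :=
      Module.finrank_zero_of_subsingleton
    rw [this, zero_add]
  rw [h]

end Additivity

/-! ### TF-equivalence classes as convex cones, and their closures -/

section Classes

variable (k : Type v) [Field k] {Λ : Type u} [Ring Λ] [Algebra k Λ] [Module.Finite k Λ]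

/-- A factor module of a finitely generated module. -/
def FinMod.quotient (M : FinMod k Λ) (N : Submodule Λ M.carrier) : FinMod k Λ where
  carrier := M.carrier ⧸ N

/-- A submodule of a finitely generated module. -/
def FinMod.sub (M : FinMod k Λ) (N : Submodule Λ M.carrier) : FinMod k Λ where
  carrier := N
  finite := finite_submodule k N

theorem FinMod.isNoetherian (M : FinMod k Λ) : IsNoetherian Λ M.carrier :=
  have : IsNoetherianRing Λ := IsNoetherianRing.of_finite k Λ
  inferInstance

theorem FinMod.isArtinian (M : FinMod k Λ) : IsArtinian Λ M.carrier :=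
  have : IsArtinianRing Λ := IsArtinianRing.of_finite k Λ
  inferInstance

/-- A module outside `T̄_θ` has a factor module in `F̄_θ` on which `θ` is negative. -/
theorem exists_quotient_mem_torfBar {θ : K0ProjReal Λ} {M : FinMod k Λ}
    (hM : M ∉ torsBar k θ) :
    ∃ N : Submodule Λ M.carrier, pairing k (M.carrier ⧸ N) θ < 0 ∧
      M.quotient k N ∈ torfBar k θ := by
  have := M.isNoetherian k
  have hne : {N : Submodule Λ M.carrier | pairing k (M.carrier ⧸ N) θ < 0}.Nonempty := by
    simpa [torsBar, Set.Nonempty] using hM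
  -- Take `N` maximal: dividing `M/N` by a nonzero `K` leaves a factor of nonnegative value, so
  -- additivity makes `K` negative.
  obtain ⟨N, hN, hmax⟩ := set_has_maximal_iff_noetherian.2 ‹_› _ hne
  have hN' : pairing k (M.carrier ⧸ N) θ < 0 := hN
  suffices H : ∀ K : Submodule Λ (M.carrier ⧸ N),
      haveI := finite_submodule k K
      pairing k K θ ≤ 0 from ⟨N, hN, H⟩
  intro K
  have := finite_submodule k K
  change pairing k K θ ≤ 0
  have hle : N ≤ K.comap N.mkQ := by
    intro x hx
    simp [(Submodule.Quotient.mk_eq_zero N).2 hx]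
  have hadd := pairing_of_exact k K.subtype (Submodule.factor hle) K.subtype_injective
    (Submodule.factor_surjective hle) (by
      intro y
      obtain ⟨x, rfl⟩ := N.mkQ_surjective y
      simp) θ
  by_cases hK : N = K.comap N.mkQ
  · have hK0 : K = ⊥ := by
      rw [← Submodule.map_comap_eq_of_surjective N.mkQ_surjective K, ← hK,
        Submodule.mkQ_map_self]
    subst hK0
    have h0 := pairing_of_exact k (0 : (⊥ : Submodule Λ (M.carrier ⧸ N)) →ₗ[Λ]
      (⊥ : Submodule Λ (M.carrier ⧸ N))) (LinearMap.id)
      (Function.injective_of_subsingleton _) Function.surjective_id (by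
        intro y; simp [Subsingleton.elim y 0]) θ
    linarith
  · have := hmax (K.comap N.mkQ)
    by_contra! hpos
    exact this (show pairing k (M.carrier ⧸ K.comap N.mkQ) θ < 0 by linarith) (lt_of_le_of_ne hle hK)

/-- A module outside `F̄_θ` has a submodule in `T̄_θ` on which `θ` is positive. -/
theorem exists_sub_mem_torsBar {θ : K0ProjReal Λ} {M : FinMod k Λ}
    (hM : M ∉ torfBar k θ) :
    ∃ N : Submodule Λ M.carrier, (haveI := finite_submodule k N; 0 < pairing k N θ) ∧
      M.sub k N ∈ torsBar k θ := by
  have := M.isArtinian k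
  have hne : {N : Submodule Λ M.carrier |
      haveI := finite_submodule k N; 0 < pairing k N θ}.Nonempty := by
    simpa [torfBar, Set.Nonempty] using hM
  -- Take `N` minimal: a proper submodule `K` has value at most zero, so `N/K` stays positive.
  obtain ⟨N, hN, hmin⟩ := IsArtinian.set_has_minimal _ hne
  refine ⟨N, hN, fun K => ?_⟩
  have hNf := finite_submodule k N
  change Submodule Λ N at K
  have hKf := finite_submodule k K
  have hKf' := finite_submodule k (K.map N.subtype)
  change 0 ≤ pairing k (N ⧸ K) θ
  have hN' : 0 < pairing k N θ := hN
  have hadd := pairing_of_exact k K.subtype K.mkQ K.subtype_injective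
    K.mkQ_surjective (LinearMap.exact_subtype_mkQ K) θ
  have he := pairing_of_equiv k (K.equivMapOfInjective N.subtype N.subtype_injective) θ
  by_cases hK : K.map N.subtype = N
  · have hK0 : K = ⊤ := by
      apply Submodule.map_injective_of_injective N.subtype_injective
      rw [hK, Submodule.map_subtype_top]
    subst hK0
    have := pairing_of_equiv k (Submodule.topEquiv (R := Λ) (M := N)) θ
    linarith
  · by_contra! hneg
    exact hmin (K.map N.subtype) (show 0 < pairing k (K.map N.subtype) θ by linarith)
      (lt_of_le_of_ne (Submodule.map_subtype_le N K) hK)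

/-- The delicate inclusion is `T̄_{η+θ} ⊆ T̄_θ`. A module violating it has a factor in `F̄_θ ⊆ F̄_η`
with `θ < 0`; there `η ≤ 0`, so `η + θ < 0`, a contradiction. The torsion-free side is dual. -/
theorem add_mem_tfClass {θ η : K0ProjReal Λ} (hT : torsBar k θ ⊆ torsBar k η)
    (hF : torfBar k θ ⊆ torfBar k η) : η + θ ∈ tfClass k θ := by
  constructor
  · refine Set.Subset.antisymm (fun M hM N => ?_) fun M hM => ?_
    · rw [map_add]
      exact add_nonneg (hT hM N) (hM N)
    · by_contra hMθ
      obtain ⟨N, hN, hNF⟩ := exists_quotient_mem_torfBar k hMθ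
      have h1 := hM N
      have h2 := hF hNF ⊤
      have h3 := pairing_of_equiv k (Submodule.topEquiv (R := Λ) (M := M.carrier ⧸ N)) η
      have h4 : pairing k (M.carrier ⧸ N) η ≤ 0 := h3 ▸ h2
      rw [map_add] at h1
      linarith
  · refine Set.Subset.antisymm (fun M hM N => ?_) fun M hM => ?_
    · have := finite_submodule k N
      change pairing k N (η + θ) ≤ 0
      rw [map_add]
      exact add_nonpos (hF hM N) (hM N)
    · by_contra hMθ
      obtain ⟨N, hN, hNT⟩ := exists_sub_mem_torsBar k hMθ
      have := finite_submodule k N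
      have h1 : pairing k N (η + θ) ≤ 0 := hM N
      have h3 := pairing_of_equiv k (Submodule.quotEquivOfEqBot (⊥ : Submodule Λ N) rfl) η
      have h4 : 0 ≤ pairing k N η := h3 ▸ hT hNT ⊥
      have hN' : 0 < pairing k N θ := hN
      rw [map_add] at h1
      linarith

theorem smul_mem_tfClass {θ : K0ProjReal Λ} {c : ℝ} (hc : 0 < c) : c • θ ∈ tfClass k θ := by
  constructor
  · ext M
    simp [torsBar, mul_nonneg_iff_of_pos_left hc]
  · ext M
    simp [torfBar, mul_nonpos_iff, hc.not_ge, hc.le]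

theorem mem_tfClass_self (θ : K0ProjReal Λ) : θ ∈ tfClass k θ := ⟨rfl, rfl⟩

theorem tfClass_add_mem {θ x y : K0ProjReal Λ} (hx : x ∈ tfClass k θ) (hy : y ∈ tfClass k θ) :
    x + y ∈ tfClass k θ := by
  have h := add_mem_tfClass k (θ := y) (η := x) (hy.1.symm.trans hx.1).subset
    (hy.2.symm.trans hx.2).subset
  exact ⟨hy.1.trans h.1, hy.2.trans h.2⟩

theorem tfClass_smul_mem {θ x : K0ProjReal Λ} {c : ℝ} (hc : 0 < c) (hx : x ∈ tfClass k θ) :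
    c • x ∈ tfClass k θ := by
  have h := smul_mem_tfClass k (θ := x) hc
  exact ⟨hx.1.trans h.1, hx.2.trans h.2⟩

theorem exists_sub_eq_of_mem_span_tfClass {θ x : K0ProjReal Λ}
    (hx : x ∈ Submodule.span ℝ (tfClass k θ)) :
    ∃ a ∈ tfClass k θ, ∃ b ∈ tfClass k θ, x = a - b := by
  induction hx using Submodule.span_induction with
  -- Zero may lie outside the class, so `x` is written as `2x - x`.
  | mem x hx => exact ⟨x + x, tfClass_add_mem k hx hx, x, hx, by abel⟩
  | zero => exact ⟨θ, mem_tfClass_self k θ, θ, mem_tfClass_self k θ, by abel⟩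
  | add x y _ _ hx hy =>
    obtain ⟨a, ha, b, hb, rfl⟩ := hx
    obtain ⟨c, hc, d, hd, rfl⟩ := hy
    exact ⟨a + c, tfClass_add_mem k ha hc, b + d, tfClass_add_mem k hb hd, by abel⟩
  | smul r x _ hx =>
    obtain ⟨a, ha, b, hb, rfl⟩ := hx
    rcases lt_trichotomy r 0 with hr | rfl | hr
    · exact ⟨(-r) • b, tfClass_smul_mem k (neg_pos.2 hr) hb, (-r) • a,
        tfClass_smul_mem k (neg_pos.2 hr) ha, by module⟩
    · exact ⟨θ, mem_tfClass_self k θ, θ, mem_tfClass_self k θ, by simp⟩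
    · exact ⟨r • a, tfClass_smul_mem k hr ha, r • b, tfClass_smul_mem k hr hb, by module⟩

theorem continuous_pairing (M : Type u) [AddCommGroup M] [Module k M] [Module Λ M]
    [IsScalarTower k Λ M] [Module.Finite Λ M] :
    Continuous (pairing (Λ := Λ) k M) :=
  IsModuleTopology.continuous_of_linearMap _

theorem torsBar_subset_of_mem_closure {θ η : K0ProjReal Λ} (h : η ∈ closure (tfClass k θ)) :
    torsBar k θ ⊆ torsBar k η := by
  intro M hM N
  refine closure_minimal (t := {x | 0 ≤ pairing k (M.carrier ⧸ N) x}) (fun x hx => ?_)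
    (isClosed_le continuous_const (continuous_pairing k _)) h
  exact (hx.1 ▸ hM : M ∈ torsBar k x) N

theorem torfBar_subset_of_mem_closure {θ η : K0ProjReal Λ} (h : η ∈ closure (tfClass k θ)) :
    torfBar k θ ⊆ torfBar k η := by
  intro M hM N
  have := finite_submodule k N
  refine closure_minimal (t := {x | pairing k N x ≤ 0}) (fun x hx => ?_)
    (isClosed_le (continuous_pairing k _) continuous_const) h
  exact (hx.2 ▸ hM : M ∈ torfBar k x) N

theorem span_tfClass_lt_of_mem_closure {θ η : K0ProjReal Λ} (h : η ∈ closure (tfClass k θ))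
    (hne : η ∉ tfClass k θ) :
    Submodule.span ℝ (tfClass k η) < Submodule.span ℝ (tfClass k θ) := by
  have key : ∀ x ∈ tfClass k η, x + θ ∈ tfClass k θ := fun x hx =>
    add_mem_tfClass k (hx.1 ▸ torsBar_subset_of_mem_closure k h)
      (hx.2 ▸ torfBar_subset_of_mem_closure k h)
  have hθ : θ ∈ Submodule.span ℝ (tfClass k θ) := Submodule.subset_span (mem_tfClass_self k θ)
  refine lt_of_le_of_ne (Submodule.span_le.2 fun x hx => ?_) fun heq => hne ?_
  · have := Submodule.sub_mem _ (Submodule.subset_span (key x hx)) hθ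
    rwa [add_sub_cancel_right] at this
  · rw [← heq] at hθ
    obtain ⟨a, ha, b, hb, hab⟩ := exists_sub_eq_of_mem_span_tfClass k hθ
    have h1 := key b hb
    -- Now `a` lies in `[θ]` by `key` and in `[η]` by choice.
    rw [show b + θ = a by rw [hab]; abel] at h1
    exact ⟨h1.1.trans ha.1.symm, h1.2.trans ha.2.symm⟩

end Classes

/-! ### Finite generation of `K₀(proj Λ)` -/

section FiniteGeneration

variable {Λ : Type u} [Ring Λ]

/-- The class `[P]` in `K₀(proj Λ)`. -/
def K0Proj.of (P : ProjMod Λ) : K0Proj Λ := QuotientAddGroup.mk (FreeAbelianGroup.of P)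

theorem K0Proj.of_eq_add {P Q R : ProjMod Λ}
    (e : R.carrier ≃ₗ[Λ] (P.carrier × Q.carrier)) :
    K0Proj.of R = K0Proj.of P + K0Proj.of Q := by
  rw [← sub_eq_zero]
  exact (QuotientAddGroup.eq_zero_iff _).2 (AddSubgroup.subset_closure ⟨P, Q, R, ⟨e⟩, rfl⟩)

theorem K0Proj.of_eq_zero {P : ProjMod Λ} [Subsingleton P.carrier] : K0Proj.of P = 0 := by
  have h := K0Proj.of_eq_add (P := P) (Q := P) (R := P)
    (LinearEquiv.ofSubsingleton P.carrier (P.carrier × P.carrier))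
  simpa using h

theorem K0Proj.of_eq_of_equiv {P Q : ProjMod Λ} (e : P.carrier ≃ₗ[Λ] Q.carrier) :
    K0Proj.of P = K0Proj.of Q := by
  let Z : ProjMod Λ := { carrier := PUnit.{u + 1} }
  have : Subsingleton Z.carrier := inferInstanceAs (Subsingleton PUnit.{u + 1})
  rw [K0Proj.of_eq_add (P := Q) (Q := Z) (e.trans (LinearEquiv.prodUnique (M₂ := PUnit.{u + 1})).symm),
    K0Proj.of_eq_zero (P := Z), add_zero]

/-- A nonzero module without nontrivial direct sum decompositions. -/
def IsIndec (Λ : Type u) [Ring Λ] (M : Type u) [AddCommGroup M] [Module Λ M] : Prop :=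
  Nontrivial M ∧ ∀ A B : Submodule Λ M, IsCompl A B → A = ⊥ ∨ B = ⊥

/-- Fitting's lemma: for large `n` the module splits as `ker fⁿ ⊕ im fⁿ`, and one summand vanishes.
-/
theorem IsIndec.bijective_of_not_isNilpotent {M : Type u} [AddCommGroup M] [Module Λ M]
    [IsNoetherian Λ M] [IsArtinian Λ M] (hM : IsIndec Λ M) {f : M →ₗ[Λ] M}
    (hf : ¬ IsNilpotent f) : Function.Bijective f := by
  have hev := f.eventually_isCompl_ker_pow_range_pow
  -- The bound `n ≥ 1` gives `ker f ⊆ ker fⁿ`.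
  obtain ⟨n, hn⟩ := (hev.and (Filter.eventually_ge_atTop 1)).exists
  rcases hM.2 _ _ hn.1 with h | h
  · have hinj : Function.Injective f := by
      rw [← LinearMap.ker_eq_bot, eq_bot_iff, ← h]
      intro x hx
      obtain ⟨m, rfl⟩ := Nat.exists_eq_add_of_le' hn.2
      rw [LinearMap.mem_ker] at hx ⊢
      rw [pow_succ, Module.End.mul_apply, hx, map_zero]
    exact IsArtinian.bijective_of_injective_endomorphism f hinj
  · exact absurd ⟨n, LinearMap.range_eq_bot.1 h⟩ hf

/-- Indecomposable projectives with a common simple factor module are isomorphic. -/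
theorem IsIndec.nonempty_equiv {P Q S : Type u} [AddCommGroup P] [Module Λ P]
    [AddCommGroup Q] [Module Λ Q] [AddCommGroup S] [Module Λ S]
    [IsNoetherian Λ P] [IsArtinian Λ P] [IsNoetherian Λ Q] [IsArtinian Λ Q]
    [Module.Projective Λ P] [Module.Projective Λ Q] [IsSimpleModule Λ S]
    (hP : IsIndec Λ P) (hQ : IsIndec Λ Q) (p : P →ₗ[Λ] S) (q : Q →ₗ[Λ] S)
    (hp : p ≠ 0) (hq : q ≠ 0) : Nonempty (P ≃ₗ[Λ] Q) := by
  have hps := LinearMap.surjective_of_ne_zero hp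
  have hqs := LinearMap.surjective_of_ne_zero hq
  -- Lifting `p` and `q` through each other gives `p ∘ (g ∘ f) = p ≠ 0`, so `g ∘ f` is not
  -- nilpotent; likewise `f ∘ g`.
  obtain ⟨f, hf⟩ := Module.projective_lifting_property q p hqs
  obtain ⟨g, hg⟩ := Module.projective_lifting_property p q hps
  have nonnil : ∀ {X : Type u} [AddCommGroup X] [Module Λ X] (r : X →ₗ[Λ] S) (h : X →ₗ[Λ] X),
      r ≠ 0 → r ∘ₗ h = r → ¬ IsNilpotent h := by
    rintro X _ _ r h hr hrh ⟨n, hn⟩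
    have : ∀ m : ℕ, r ∘ₗ (h ^ m) = r := by
      intro m
      induction m with
      | zero => rfl
      | succ m ih => rw [pow_succ, Module.End.mul_eq_comp, ← LinearMap.comp_assoc, ih, hrh]
    apply hr
    rw [← this n, hn, LinearMap.comp_zero]
  have h1 := hP.bijective_of_not_isNilpotent (nonnil p (g ∘ₗ f) hp (by
    rw [← LinearMap.comp_assoc, hg, hf]))
  have h2 := hQ.bijective_of_not_isNilpotent (nonnil q (f ∘ₗ g) hq (by
    rw [← LinearMap.comp_assoc, hf, hg]))
  rw [LinearMap.coe_comp] at h1 h2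
  exact ⟨LinearEquiv.ofBijective f ⟨h1.1.of_comp, h2.2.of_comp⟩⟩

variable [IsArtinianRing Λ]

/-- A finitely generated projective module is a sum of finitely many indecomposables in `K₀`, and
each of its simple factor modules is a factor of one of them. -/
theorem exists_finite_indec (P : ProjMod Λ) :
    ∃ T : Set (ProjMod Λ), T.Finite ∧ (∀ Q ∈ T, IsIndec Λ Q.carrier) ∧
      K0Proj.of P ∈ AddSubgroup.closure (K0Proj.of '' T) ∧
      ∀ (S : Type u) [AddCommGroup S] [Module Λ S] (f : P.carrier →ₗ[Λ] S), f ≠ 0 →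
        ∃ Q ∈ T, ∃ g : Q.carrier →ₗ[Λ] S, g ≠ 0 := by
  -- Realising every summand inside the fixed Artinian module `P` supplies a well-founded order for
  -- the induction.
  suffices H : ∀ N : Submodule Λ P.carrier, ∀ R : ProjMod Λ, Nonempty (R.carrier ≃ₗ[Λ] N) →
      ∃ T : Set (ProjMod Λ), T.Finite ∧ (∀ Q ∈ T, IsIndec Λ Q.carrier) ∧
      K0Proj.of R ∈ AddSubgroup.closure (K0Proj.of '' T) ∧
      ∀ (S : Type u) [AddCommGroup S] [Module Λ S] (f : R.carrier →ₗ[Λ] S), f ≠ 0 →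
        ∃ Q ∈ T, ∃ g : Q.carrier →ₗ[Λ] S, g ≠ 0 from
    H ⊤ P ⟨Submodule.topEquiv.symm⟩
  intro N
  induction N using WellFoundedLT.induction with
  | ind N ih =>
  rintro R ⟨e⟩
  rcases subsingleton_or_nontrivial R.carrier with hR | hR
  · refine ⟨∅, Set.finite_empty, by simp, by simp [K0Proj.of_eq_zero], ?_⟩
    intro S _ _ f hf
    exact absurd (LinearMap.ext fun x => by simp [Subsingleton.elim x 0]) hf
  by_cases hI : IsIndec Λ R.carrier
  · refine ⟨{R}, Set.finite_singleton R, by simpa using hI,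
      AddSubgroup.subset_closure ⟨R, rfl, rfl⟩, ?_⟩
    intro S _ _ f hf
    exact ⟨R, rfl, f, hf⟩
  obtain ⟨A, B, hAB, hA, hB⟩ : ∃ A B : Submodule Λ R.carrier, IsCompl A B ∧ A ≠ ⊥ ∧ B ≠ ⊥ := by
    simpa [IsIndec, hR] using hI
  have summand : ∀ {A B : Submodule Λ R.carrier}, IsCompl A B → B ≠ ⊥ →
      ∃ (Q : ProjMod Λ) (i : A ≃ₗ[Λ] Q.carrier) (M : Submodule Λ P.carrier), M < N ∧
        Nonempty (Q.carrier ≃ₗ[Λ] M) := by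
    intro A B hAB hB
    have : Module.Projective Λ A := Module.Projective.of_split A.subtype
      (A.projectionOnto B hAB) (by ext x; simp)
    let j : R.carrier →ₗ[Λ] P.carrier := N.subtype ∘ₗ e.toLinearMap
    have hj : Function.Injective j := N.subtype_injective.comp e.injective
    refine ⟨{ carrier := A }, LinearEquiv.refl Λ A, A.map j, ?_,
      ⟨A.equivMapOfInjective j hj⟩⟩
    have hjt : (⊤ : Submodule Λ R.carrier).map j = N := by
      rw [Submodule.map_comp, Submodule.map_top, LinearEquiv.range, Submodule.map_subtype_top]
    rw [← hjt]
    refine lt_of_le_of_ne (Submodule.map_mono le_top) fun h => hB ?_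
    have hAt := Submodule.map_injective_of_injective hj h
    subst hAt
    simpa using hAB.disjoint
  obtain ⟨Q₁, i₁, M₁, hM₁, e₁⟩ := summand hAB hB
  obtain ⟨Q₂, i₂, M₂, hM₂, e₂⟩ := summand hAB.symm hA
  obtain ⟨T₁, hf₁, hI₁, hc₁, hS₁⟩ := ih M₁ hM₁ Q₁ e₁
  obtain ⟨T₂, hf₂, hI₂, hc₂, hS₂⟩ := ih M₂ hM₂ Q₂ e₂
  refine ⟨T₁ ∪ T₂, hf₁.union hf₂, ?_, ?_, ?_⟩
  · rintro Q (hQ | hQ)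
    exacts [hI₁ Q hQ, hI₂ Q hQ]
  · rw [K0Proj.of_eq_add ((A.prodEquivOfIsCompl B hAB).symm.trans (i₁.prodCongr i₂))]
    refine add_mem (AddSubgroup.closure_mono (Set.image_mono Set.subset_union_left) hc₁)
      (AddSubgroup.closure_mono (Set.image_mono Set.subset_union_right) hc₂)
  · intro S _ _ f hf
    by_cases h1 : f ∘ₗ A.subtype ∘ₗ i₁.symm.toLinearMap = 0
    · by_cases h2 : f ∘ₗ B.subtype ∘ₗ i₂.symm.toLinearMap = 0
      · refine absurd ?_ hf
        have hA' : A ≤ LinearMap.ker f := fun x hx => by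
          simpa using LinearMap.congr_fun h1 (i₁ ⟨x, hx⟩)
        have hB' : B ≤ LinearMap.ker f := fun x hx => by
          simpa using LinearMap.congr_fun h2 (i₂ ⟨x, hx⟩)
        rw [← LinearMap.ker_eq_top, eq_top_iff, ← hAB.sup_eq_top]
        exact sup_le hA' hB'
      · obtain ⟨Q, hQ, g, hg⟩ := hS₂ S _ h2
        exact ⟨Q, Or.inr hQ, g, hg⟩
    · obtain ⟨Q, hQ, g, hg⟩ := hS₁ S _ h1
      exact ⟨Q, Or.inl hQ, g, hg⟩

/-- The indecomposable summands of `Λ` suffice as generators. Any indecomposable projective has a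
simple factor `S`; since `Λ` maps nontrivially to `S`, so does one of these summands, and the two
are then isomorphic. -/
theorem K0Proj.fg : AddGroup.FG (K0Proj Λ) := by
  obtain ⟨T, hT, hTI, -, hTS⟩ := exists_finite_indec ({ carrier := Λ } : ProjMod Λ)
  have hindec : ∀ P : ProjMod Λ, IsIndec Λ P.carrier →
      K0Proj.of P ∈ AddSubgroup.closure (K0Proj.of '' T) := by
    intro P hP
    have := hP.1
    obtain ⟨N, hN⟩ := IsCoatomic.exists_coatom (α := Submodule Λ P.carrier)
    have hS : IsSimpleModule Λ (P.carrier ⧸ N) := isSimpleModule_iff_isCoatom.2 hN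
    have := IsSimpleModule.nontrivial Λ (P.carrier ⧸ N)
    obtain ⟨s, hs⟩ := exists_ne (0 : P.carrier ⧸ N)
    obtain ⟨Q, hQ, g, hg⟩ := hTS (P.carrier ⧸ N) (LinearMap.toSpanSingleton Λ _ s) (by
      intro h
      exact hs (by simpa using LinearMap.congr_fun h 1))
    have hmk : N.mkQ ≠ 0 := by
      intro h
      obtain ⟨x, rfl⟩ := N.mkQ_surjective s
      exact hs (LinearMap.congr_fun h x)
    obtain ⟨e⟩ := hP.nonempty_equiv (hTI Q hQ) N.mkQ g hmk hg
    rw [K0Proj.of_eq_of_equiv e]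
    exact AddSubgroup.subset_closure ⟨Q, hQ, rfl⟩
  refine AddGroup.fg_iff.2 ⟨K0Proj.of '' T, ?_, hT.image _⟩
  refine eq_top_iff.2 fun x _ => ?_
  obtain ⟨x, rfl⟩ := QuotientAddGroup.mk_surjective x
  have hof : ∀ P : ProjMod Λ, K0Proj.of P ∈ AddSubgroup.closure (K0Proj.of '' T) := by
    intro P
    obtain ⟨U, -, hUI, hU, -⟩ := exists_finite_indec P
    refine (AddSubgroup.closure_le _).2 ?_ hU
    rintro _ ⟨Q, hQ, rfl⟩
    exact hindec Q (hUI Q hQ)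
  induction x using FreeAbelianGroup.induction_on with
  | zero => exact zero_mem _
  | of P => exact hof P
  | neg P hP => exact neg_mem (hof P)
  | add a b ha hb => exact add_mem (ha trivial) (hb trivial)

theorem K0ProjReal.finite : Module.Finite ℝ (K0ProjReal Λ) := by
  have : Module.Finite ℤ (K0Proj Λ) := Module.Finite.iff_addGroup_fg.2 K0Proj.fg
  infer_instance

end FiniteGeneration

end TFClasses

theorem mainTheorem8 (k : Type*) [Field k] [IsAlgClosed k]
    (Λ : Type*) [Ring Λ] [Algebra k Λ] [Module.Finite k Λ]
    (θ η : TFClasses.K0ProjReal Λ)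
    (hη : η ∈ TFClasses.relBoundary (TFClasses.tfClass k θ) \ TFClasses.tfClass k θ) :
    Module.finrank ℝ (Submodule.span ℝ (TFClasses.tfClass k η)) <
      Module.finrank ℝ (Submodule.span ℝ (TFClasses.tfClass k θ)) := by
  have : IsArtinianRing Λ := IsArtinianRing.of_finite k Λ
  have := TFClasses.K0ProjReal.finite (Λ := Λ)
  exact Submodule.finrank_lt_finrank_of_lt
    (TFClasses.span_tfClass_lt_of_mem_closure k hη.1.1 hη.2)
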